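/- Let $Q_2=\sum_{i+j=2}q_{ij}x^iy^j\in\mathbb C[x,y]$ and $H_4=\sum_{i+j+k=4}h_{ijk}x^iy^jz^k\in\mathbb C[x,y,z]$ be forms with $$h_{400}=h_{310}=q_{20}=0,\qquad h_{301}\neq 0,$$ and let $S\subset\mathbb P^3(\mathbb C)$, with homogeneous coordinates $(x:y:z:w)$, be the quartic surface $$w^2z^2+w\,(y^3+zQ_2(x,y))+H_4(x,y,z)=0 .$$ Assume that $S$ contains only finitely many lines. Put $O=(0:0:0:1)$, let $\ell_0$ be the (unique) line on $S$ through $O$, and let $C_OS$ be the reduced tangent cone of $S$ at $O$, which is a plane. Write $S.(C_OS)$ for the plane section of $S$ by $C_OS$, counted with multiplicities. (a) If $S.(C_OS)=2\ell_0+C$ with $C$ an irreducible conic, then at most $27$ lines on $S$ meet $C$. (b) If $S.(C_OS)=3\ell_0+\ell_1$ with $\ell_1$ a line, then at most $23$ lines on $S$ meet $\ell_1$ (the line $\ell_1$ itself included in the count). -/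

import Mathlib

open MvPolynomial
open scoped LinearAlgebra.Projectivization

/-- Complex projective three-space, with homogeneous coordinates
`(x : y : z : w) = (v 0 : v 1 : v 2 : v 3)`. -/
abbrev P3 : Type := ℙ ℂ (Fin 4 → ℂ)

/-- The ring `ℂ[x, y, z, w]`, with `x = X 0`, `y = X 1`, `z = X 2`, `w = X 3`. -/
abbrev Poly4 : Type := MvPolynomial (Fin 4) ℂ

/-- The common zeroes in `P3` of a set of polynomials. A point is a zero of `f` when `f` vanishes
at all the vectors of the one-dimensional subspace it stands for; for a homogeneous `f` this is the
vanishing of `f` at any one vector of homogeneous coordinates. -/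
def projZeros (s : Set Poly4) : Set P3 :=
  {p | ∀ f ∈ s, ∀ v ∈ p.submodule, eval v f = 0}

/-- A line in `P3`: the points of a two-dimensional linear subspace. -/
def IsLine (L : Set P3) : Prop :=
  ∃ W : Submodule ℂ (Fin 4 → ℂ), Module.finrank ℂ W = 2 ∧ L = {p : P3 | p.submodule ≤ W}

/-- The set of the lines that lie on the surface `F = 0`. -/
def linesOn (F : Poly4) : Set (Set P3) :=
  {L | IsLine L ∧ L ⊆ projZeros {F}}

/-- The point `O = (0 : 0 : 0 : 1)`. -/
noncomputable def pointO : P3 :=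
  Projectivization.mk ℂ (![0, 0, 0, 1] : Fin 4 → ℂ) (by simp)

/-- The binary form `Q₂ = ∑_{i+j=2} q_{ij} x^i y^j`. -/
noncomputable def formQ2 (q : ℕ → ℕ → ℂ) : Poly4 :=
  ∑ a ∈ Finset.HasAntidiagonal.antidiagonal 2, C (q a.1 a.2) * X 0 ^ a.1 * X 1 ^ a.2

/-- The ternary form `H₄ = ∑_{i+j+k=4} h_{ijk} x^i y^j z^k`. -/
noncomputable def formH4 (h : ℕ → ℕ → ℕ → ℂ) : Poly4 :=
  ∑ a ∈ Finset.HasAntidiagonal.antidiagonal 4, ∑ b ∈ Finset.HasAntidiagonal.antidiagonal a.2,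
    C (h a.1 b.1 b.2) * X 0 ^ a.1 * X 1 ^ b.1 * X 2 ^ b.2

/-- The quartic form `w² z² + w (y³ + z Q₂) + H₄`. -/
noncomputable def quarticForm (q : ℕ → ℕ → ℂ) (h : ℕ → ℕ → ℕ → ℂ) : Poly4 :=
  X 3 ^ 2 * X 2 ^ 2 + X 3 * (X 1 ^ 3 + X 2 * formQ2 q) + formH4 h

/-- The conditions on the coefficients which single out the family (Q5). -/
def Q5Conditions (q : ℕ → ℕ → ℂ) (h : ℕ → ℕ → ℕ → ℂ) : Prop :=
  h 4 0 0 = 0 ∧ h 3 1 0 = 0 ∧ q 2 0 = 0 ∧ h 3 0 1 ≠ 0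

/-- The equation of the surface `F = 0` in the affine coordinates `x, y, z` centred at `O`,
that is `F(x, y, z, 1)`. -/
noncomputable def affineEquation (F : Poly4) : Poly4 :=
  aeval (![X 0, X 1, X 2, 1] : Fin 4 → Poly4) F

/-- The initial form at `O` of the surface `F = 0`: the nonzero homogeneous component of lowest
degree of its affine equation. -/
noncomputable def initialForm (F : Poly4) : Poly4 :=
  homogeneousComponent (sInf {m : ℕ | homogeneousComponent m (affineEquation F) ≠ 0})
    (affineEquation F)

/-- The homogeneous ideal of the reduced tangent cone `C_O S` of the surface `S : F = 0`. -/
noncomputable def tangentConeIdeal (F : Poly4) : Ideal Poly4 :=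
  (Ideal.span {initialForm F}).radical

/-- For a plane with homogeneous ideal `I`: `D` is the irreducible curve of degree `d` in the plane
whose equation is the form `G`, read in the homogeneous coordinate ring of the plane. -/
def IsIrreduciblePlaneCurve (I : Ideal Poly4) (d : ℕ) (G : Poly4) (D : Set P3) : Prop :=
  G.IsHomogeneous d ∧ Irreducible (Ideal.Quotient.mk I G) ∧ D = projZeros (insert G (I : Set Poly4))

/-- `S.(C_O S) = m • D + D'` as cycles, for the surface `S : F = 0` whose reduced tangent cone at
`O` is a plane, where `D` and `D'` are irreducible curves in that plane, of degrees `d` and `d'`: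
the restriction of `F` to the plane is the product of the `m`-th power of an equation of `D` and an
equation of `D'`. -/
def TangentConeSectionEq (F : Poly4) (m d : ℕ) (D : Set P3) (d' : ℕ) (D' : Set P3) : Prop :=
  ∃ G G' : Poly4,
    IsIrreduciblePlaneCurve (tangentConeIdeal F) d G D ∧
    IsIrreduciblePlaneCurve (tangentConeIdeal F) d' G' D' ∧
    Ideal.Quotient.mk (tangentConeIdeal F) F =
      Ideal.Quotient.mk (tangentConeIdeal F) G ^ m * Ideal.Quotient.mk (tangentConeIdeal F) G'

/-! ### Counting the common zeros of polynomials in two variables -/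

/-! Both bounds follow from one stronger fact: the surface, if it contains finitely many lines,
contains at most 22.

On `z = 0` the quartic restricts to `y² (w y + h₂₂₀ x² + h₁₃₀ x y + h₀₄₀ y²)`, so that plane carries
at most two of the lines: `y = z = 0`, and a component of the residual conic when `h₂₂₀ = 0`. A line
on the surface but outside the plane does not meet `y = z = 0` (here `h₃₀₁ ≠ 0` enters), so it joins
a unique `(s : 1 : 0 : w)` to a unique `(a : 0 : 1 : c)`. Expanding the quartic along it, the
conditions of orders 0 and 1 determine `w` and `c`, and those of orders 2, 3, 4 are three equations
in `(s, a)`. With `s` of weight 1 and `a` of weight 2, they have weights at most 4, 5, 6; in `a`,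
the first has constant leading coefficient `h₂₂₀` and the last `h₃₀₁`.

Eliminating `a` leaves a polynomial in `s`. If every eliminant vanished, the equations would share a
solution for almost every `s`, giving infinitely many lines. So some eliminant is nonzero, and its
degree bounds the pairs by 20 (`encard_contactPairs_le`). -/

theorem encard_le_mul_natDegree {Z : Set (ℂ × ℂ)} {R : Polynomial ℂ} (hR : R ≠ 0) {k : ℕ}
    (F : ℂ → Polynomial ℂ) (hF0 : ∀ s, F s ≠ 0) (hF : ∀ s, (F s).natDegree ≤ k)
    (hZR : ∀ z ∈ Z, R.eval z.1 = 0) (hZF : ∀ z ∈ Z, (F z.1).eval z.2 = 0) :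
    Z.encard ≤ ((R.natDegree * k : ℕ) : ℕ∞) := by
  classical
  let T : Finset (ℂ × ℂ) := R.roots.toFinset.biUnion fun s => (F s).roots.toFinset.image (Prod.mk s)
  have hsub : Z ⊆ T := by
    intro z hz
    simp only [T, Finset.coe_biUnion, Set.mem_iUnion, Finset.mem_coe, Finset.mem_image,
      Multiset.mem_toFinset, Polynomial.mem_roots', Polynomial.IsRoot.def]
    exact ⟨z.1, ⟨hR, hZR z hz⟩, z.2, ⟨hF0 _, hZF z hz⟩, rfl⟩
  have hcard : T.card ≤ R.natDegree * k := by
    refine (Finset.card_biUnion_le_card_mul _ _ k fun s _ => ?_).trans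
      (Nat.mul_le_mul_right _ ((Multiset.toFinset_card_le _).trans (Polynomial.card_roots' R)))
    exact Finset.card_image_le.trans ((Multiset.toFinset_card_le _).trans
      ((Polynomial.card_roots' _).trans (hF s)))
  calc Z.encard ≤ (T : Set (ℂ × ℂ)).encard := Set.encard_le_encard hsub
    _ = (T.card : ℕ∞) := Set.encard_coe_eq_coe_finsetCard T
    _ ≤ _ := by exact_mod_cast hcard

/-- Away from the zeros of `P` the second coordinate is a function of the first, so `R` alone bounds
the points; over each zero of `P` the fibre bound `k` is used. -/
theorem encard_le_natDegree_add_mul {Z : Set (ℂ × ℂ)} {R P : Polynomial ℂ} (hR : R ≠ 0)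
    (hP : P ≠ 0) {k : ℕ} (F : ℂ → Polynomial ℂ) (hF0 : ∀ s, F s ≠ 0)
    (hF : ∀ s, (F s).natDegree ≤ k) (φ : ℂ → ℂ)
    (hZR : ∀ z ∈ Z, R.eval z.1 = 0) (hZF : ∀ z ∈ Z, (F z.1).eval z.2 = 0)
    (hφ : ∀ z ∈ Z, P.eval z.1 ≠ 0 → z.2 = φ z.1) :
    Z.encard ≤ ((R.natDegree + P.natDegree * k : ℕ) : ℕ∞) := by
  have h1 : {z ∈ Z | P.eval z.1 = 0}.encard ≤ ((P.natDegree * k : ℕ) : ℕ∞) :=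
    encard_le_mul_natDegree hP F hF0 hF (fun z hz => hz.2) fun z hz => hZF z hz.1
  have h2 : {z ∈ Z | P.eval z.1 ≠ 0}.encard ≤ ((R.natDegree * 1 : ℕ) : ℕ∞) :=
    encard_le_mul_natDegree hR (fun s => Polynomial.X - Polynomial.C (φ s))
      (fun s => Polynomial.X_sub_C_ne_zero _) (fun s => (Polynomial.natDegree_X_sub_C _).le)
      (fun z hz => hZR z hz.1) fun z hz => by simp [hφ z hz.1 hz.2]
  have hZ : Z = {z ∈ Z | P.eval z.1 ≠ 0} ∪ {z ∈ Z | P.eval z.1 = 0} := by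
    ext z; simp only [Set.mem_union, Set.mem_ofPred_eq]; tauto
  calc Z.encard ≤ _ := (congrArg Set.encard hZ).le.trans (Set.encard_union_le _ _)
    _ ≤ _ := add_le_add h2 h1
    _ = _ := by push_cast; simp

theorem infinite_of_forall_exists {Z : Set (ℂ × ℂ)} {P : Polynomial ℂ} (hP : P ≠ 0)
    (h : ∀ s, P.eval s ≠ 0 → ∃ a, (s, a) ∈ Z) : Z.Infinite := by
  classical
  intro hZ
  refine Set.infinite_univ (α := ℂ) (((hZ.image Prod.fst).union
    P.roots.toFinset.finite_toSet).subset fun s _ => ?_)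
  by_cases hs : P.eval s = 0
  · right; simp [hP, hs]
  · obtain ⟨a, ha⟩ := h s hs
    exact Or.inl ⟨_, ha, rfl⟩

theorem quadratic_ne_zero {α : ℂ} (hα : α ≠ 0) (b c : ℂ) :
    Polynomial.C α * Polynomial.X ^ 2 + Polynomial.C b * Polynomial.X + Polynomial.C c ≠ 0 := by
  intro h
  simpa [h] using Polynomial.natDegree_quadratic (b := b) (c := c) hα

theorem cubic_ne_zero {α : ℂ} (hα : α ≠ 0) (b c d : ℂ) :
    Polynomial.C α * Polynomial.X ^ 3 + Polynomial.C b * Polynomial.X ^ 2 +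
      Polynomial.C c * Polynomial.X + Polynomial.C d ≠ 0 := by
  intro h
  simpa [h] using Polynomial.natDegree_cubic (b := b) (c := c) (d := d) hα

/-- The common zeros of a quadratic and a linear polynomial in the second variable whose
resultant `N` is nonzero. -/
theorem encard_quadratic_linear_le {Z : Set (ℂ × ℂ)} {α : ℂ} (hα : α ≠ 0)
    {e₁ e₀ p r : Polynomial ℂ} (he₁ : e₁.natDegree ≤ 2) (he₀ : e₀.natDegree ≤ 4)
    (hp : p.natDegree ≤ 4) (hr : r.natDegree ≤ 6)
    (hN : Polynomial.C α * r ^ 2 - e₁ * p * r + e₀ * p ^ 2 ≠ 0)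
    (hZ : ∀ z ∈ Z, α * z.2 ^ 2 + e₁.eval z.1 * z.2 + e₀.eval z.1 = 0)
    (hZ' : ∀ z ∈ Z, p.eval z.1 * z.2 + r.eval z.1 = 0) : Z.encard ≤ 20 := by
  let F : ℂ → Polynomial ℂ := fun s => Polynomial.C α * Polynomial.X ^ 2 +
    Polynomial.C (e₁.eval s) * Polynomial.X + Polynomial.C (e₀.eval s)
  have hF0 : ∀ s, F s ≠ 0 := fun s => quadratic_ne_zero hα _ _
  have hF : ∀ s, (F s).natDegree ≤ 2 := fun s => Polynomial.natDegree_quadratic_le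
  have hZF : ∀ z ∈ Z, (F z.1).eval z.2 = 0 := fun z hz => by simpa [F] using hZ z hz
  -- If `p = 0`, the resultant is `α r²`, so `r ≠ 0` and the count is at most `6 · 2`. Otherwise `a
  -- = -r / p` off the zeros of `p`, and the count is at most `12 + 4 · 2`.
  by_cases hp0 : p = 0
  · have hr0 : r ≠ 0 := by rintro rfl; simp [hp0] at hN
    refine (encard_le_mul_natDegree hr0 F hF0 hF (fun z hz => ?_) hZF).trans ?_
    · simpa [hp0] using hZ' z hz
    · exact_mod_cast (by omega : r.natDegree * 2 ≤ 20)
  · have hd : (Polynomial.C α * r ^ 2 - e₁ * p * r + e₀ * p ^ 2).natDegree ≤ 12 := by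
      refine Polynomial.natDegree_add_le_of_degree_le (Polynomial.natDegree_sub_le_of_le
        (n := 12) (Polynomial.natDegree_mul_le_of_le (m := 0) (n := 12) (by simp)
          (Polynomial.natDegree_pow_le_of_le 2 hr))
        (Polynomial.natDegree_mul_le_of_le (Polynomial.natDegree_mul_le_of_le he₁ hp) hr))
        (Polynomial.natDegree_mul_le_of_le he₀ (Polynomial.natDegree_pow_le_of_le 2 hp))
    refine (encard_le_natDegree_add_mul hN hp0 F hF0 hF (fun s => -r.eval s / p.eval s)
      (fun z hz => ?_) hZF fun z hz hz0 => ?_).trans ?_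
    · have h1 := hZ z hz
      have h2 := hZ' z hz
      simp only [Polynomial.eval_add, Polynomial.eval_sub, Polynomial.eval_mul,
        Polynomial.eval_pow, Polynomial.eval_C]
      linear_combination (p.eval z.1) ^ 2 * h1 + (α * (r.eval z.1 - p.eval z.1 * z.2) -
        e₁.eval z.1 * p.eval z.1) * h2
    · rw [eq_div_iff hz0]; linear_combination hZ' z hz
    · exact_mod_cast (by omega : _ + p.natDegree * 2 ≤ 20)

/-- A finite set of common zeros of a quadratic polynomial with constant leading coefficient and
of two linear ones has at most `20` elements. -/
theorem encard_quadratic_linear_linear_le {α : ℂ} (hα : α ≠ 0)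
    {e₁ e₀ p r p' r' : Polynomial ℂ} (he₁ : e₁.natDegree ≤ 2) (he₀ : e₀.natDegree ≤ 4)
    (hp : p.natDegree ≤ 3) (hr : r.natDegree ≤ 5) (hp' : p'.natDegree ≤ 4) (hr' : r'.natDegree ≤ 6)
    (hfin : {z : ℂ × ℂ | α * z.2 ^ 2 + e₁.eval z.1 * z.2 + e₀.eval z.1 = 0 ∧
      p.eval z.1 * z.2 + r.eval z.1 = 0 ∧ p'.eval z.1 * z.2 + r'.eval z.1 = 0}.Finite) :
    {z : ℂ × ℂ | α * z.2 ^ 2 + e₁.eval z.1 * z.2 + e₀.eval z.1 = 0 ∧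
      p.eval z.1 * z.2 + r.eval z.1 = 0 ∧
      p'.eval z.1 * z.2 + r'.eval z.1 = 0}.encard ≤ 20 := by
  by_cases hN : Polynomial.C α * r ^ 2 - e₁ * p * r + e₀ * p ^ 2 = 0
  swap
  · exact encard_quadratic_linear_le hα he₁ he₀ (hp.trans (by norm_num)) (hr.trans (by norm_num))
      hN (fun z hz => hz.1) fun z hz => hz.2.1
  by_cases hN' : Polynomial.C α * r' ^ 2 - e₁ * p' * r' + e₀ * p' ^ 2 = 0
  swap
  · exact encard_quadratic_linear_le hα he₁ he₀ hp' hr' hN' (fun z hz => hz.1) fun z hz => hz.2.2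
  by_cases hD : p * r' - p' * r = 0
  swap
  · have hd : (p * r' - p' * r).natDegree ≤ 9 :=
      Polynomial.natDegree_sub_le_of_le (Polynomial.natDegree_mul_le_of_le hp hr')
        (Polynomial.natDegree_mul_le_of_le hp' hr)
    refine (encard_le_mul_natDegree (k := 2) hD (fun s => Polynomial.C α * Polynomial.X ^ 2 +
      Polynomial.C (e₁.eval s) * Polynomial.X + Polynomial.C (e₀.eval s))
      (fun s => quadratic_ne_zero hα _ _) (fun s => Polynomial.natDegree_quadratic_le)
      (fun z hz => ?_) fun z hz => by simpa using hz.1).trans ?_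
    · simp only [Polynomial.eval_sub, Polynomial.eval_mul]
      linear_combination p.eval z.1 * hz.2.2 - p'.eval z.1 * hz.2.1
    · exact_mod_cast (by omega : (p * r' - p' * r).natDegree * 2 ≤ 20)
  -- Now both resultants with the quadratic vanish, and so does the resultant of the two linear
  -- equations. A common solution `a` then exists over all but finitely many `s`: a root `-r / p` or
  -- `-r' / p'`, or any root of the quadratic if both linear equations are trivial.
  exfalso
  have key : ∀ P R : Polynomial ℂ, Polynomial.C α * R ^ 2 - e₁ * P * R + e₀ * P ^ 2 = 0 →
      ∀ s, P.eval s ≠ 0 → α * (-R.eval s / P.eval s) ^ 2 +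
        e₁.eval s * (-R.eval s / P.eval s) + e₀.eval s = 0 := by
    intro P R hPR s hs
    have := congrArg (Polynomial.eval s) hPR
    simp only [Polynomial.eval_add, Polynomial.eval_sub, Polynomial.eval_mul,
        Polynomial.eval_pow, Polynomial.eval_C, Polynomial.eval_zero] at this
    field_simp
    linear_combination this
  have key0 : ∀ R : Polynomial ℂ, Polynomial.C α * R ^ 2 = 0 → R = 0 := by
    intro R hR
    simpa [hα] using hR
  have hDs : ∀ s, p.eval s * r'.eval s - p'.eval s * r.eval s = 0 := fun s => by
    simpa using congrArg (Polynomial.eval s) hD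
  by_cases hp0 : p = 0
  · have hr0 : r = 0 := key0 r (by simpa [hp0] using hN)
    by_cases hp0' : p' = 0
    · have hr0' : r' = 0 := key0 r' (by simpa [hp0'] using hN')
      refine infinite_of_forall_exists (P := 1) one_ne_zero (fun s _ => ?_) hfin
      obtain ⟨a, ha⟩ := IsAlgClosed.exists_root (Polynomial.C α * Polynomial.X ^ 2 +
        Polynomial.C (e₁.eval s) * Polynomial.X + Polynomial.C (e₀.eval s))
        (by rw [Polynomial.degree_quadratic hα]; decide)
      refine ⟨a, by simpa using ha, by simp [hp0, hr0], by simp [hp0', hr0']⟩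
    · refine infinite_of_forall_exists hp0' (fun s hs => ?_) hfin
      refine ⟨-r'.eval s / p'.eval s, key p' r' hN' s hs, by simp [hp0, hr0], ?_⟩
      simp only
      field_simp
      ring
  · refine infinite_of_forall_exists hp0 (fun s hs => ?_) hfin
    refine ⟨-r.eval s / p.eval s, key p r hN s hs, ?_, ?_⟩
    · simp only
      field_simp
      ring
    · simp only
      field_simp
      linear_combination hDs s

/-- Since `α` is a nonzero constant, reducing the other two equations modulo the first makes them
linear in the second variable without changing the solution set. -/
theorem encard_quadratic_quadratic_cubic_le {α β : ℂ} (hα : α ≠ 0)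
    {e₁ e₀ f₂ f₁ f₀ g₂ g₁ g₀ : Polynomial ℂ}
    (he₁ : e₁.natDegree ≤ 2) (he₀ : e₀.natDegree ≤ 4)
    (hf₂ : f₂.natDegree ≤ 1) (hf₁ : f₁.natDegree ≤ 3) (hf₀ : f₀.natDegree ≤ 5)
    (hg₂ : g₂.natDegree ≤ 2) (hg₁ : g₁.natDegree ≤ 4) (hg₀ : g₀.natDegree ≤ 6)
    (hfin : {z : ℂ × ℂ | α * z.2 ^ 2 + e₁.eval z.1 * z.2 + e₀.eval z.1 = 0 ∧
      f₂.eval z.1 * z.2 ^ 2 + f₁.eval z.1 * z.2 + f₀.eval z.1 = 0 ∧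
      β * z.2 ^ 3 + g₂.eval z.1 * z.2 ^ 2 + g₁.eval z.1 * z.2 + g₀.eval z.1 = 0}.Finite) :
    {z : ℂ × ℂ | α * z.2 ^ 2 + e₁.eval z.1 * z.2 + e₀.eval z.1 = 0 ∧
      f₂.eval z.1 * z.2 ^ 2 + f₁.eval z.1 * z.2 + f₀.eval z.1 = 0 ∧
      β * z.2 ^ 3 + g₂.eval z.1 * z.2 ^ 2 + g₁.eval z.1 * z.2 + g₀.eval z.1 = 0}.encard ≤ 20 := by
  have hC : ∀ c : ℂ, (Polynomial.C c).natDegree ≤ 0 := fun c => (Polynomial.natDegree_C c).le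
  have hp : (Polynomial.C α * f₁ - f₂ * e₁).natDegree ≤ 3 :=
    Polynomial.natDegree_sub_le_of_le (Polynomial.natDegree_mul_le_of_le (hC _) hf₁)
      (Polynomial.natDegree_mul_le_of_le hf₂ he₁)
  have hr : (Polynomial.C α * f₀ - f₂ * e₀).natDegree ≤ 5 :=
    Polynomial.natDegree_sub_le_of_le (Polynomial.natDegree_mul_le_of_le (hC _) hf₀)
      (Polynomial.natDegree_mul_le_of_le hf₂ he₀)
  have hp' : (Polynomial.C β * (e₁ ^ 2 - Polynomial.C α * e₀) - Polynomial.C α * (g₂ * e₁) +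
      Polynomial.C (α ^ 2) * g₁).natDegree ≤ 4 :=
    Polynomial.natDegree_add_le_of_degree_le (Polynomial.natDegree_sub_le_of_le (n := 4)
      (Polynomial.natDegree_mul_le_of_le (m := 0) (n := 4) (hC _) (Polynomial.natDegree_sub_le_of_le
        (n := 4) (Polynomial.natDegree_pow_le_of_le 2 he₁)
        (Polynomial.natDegree_mul_le_of_le (m := 0) (n := 4) (hC _) he₀)))
      (Polynomial.natDegree_mul_le_of_le (m := 0) (n := 4) (hC _)
        (Polynomial.natDegree_mul_le_of_le hg₂ he₁)))
      (Polynomial.natDegree_mul_le_of_le (m := 0) (n := 4) (hC _) hg₁)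
  have hr' : (Polynomial.C β * (e₁ * e₀) - Polynomial.C α * (g₂ * e₀) +
      Polynomial.C (α ^ 2) * g₀).natDegree ≤ 6 :=
    Polynomial.natDegree_add_le_of_degree_le (Polynomial.natDegree_sub_le_of_le (n := 6)
      (Polynomial.natDegree_mul_le_of_le (m := 0) (n := 6) (hC _)
        (Polynomial.natDegree_mul_le_of_le he₁ he₀))
      (Polynomial.natDegree_mul_le_of_le (m := 0) (n := 6) (hC _)
        (Polynomial.natDegree_mul_le_of_le hg₂ he₀)))
      (Polynomial.natDegree_mul_le_of_le (m := 0) (n := 6) (hC _) hg₀)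
  have key := encard_quadratic_linear_linear_le hα he₁ he₀ hp hr hp' hr'
  -- The linear equations are remainders on division by the first quadratic, of `α` times the second
  -- quadratic and `α²` times the cubic; these factors avoid denominators.
  have hset : ∀ z : ℂ × ℂ, (α * z.2 ^ 2 + e₁.eval z.1 * z.2 + e₀.eval z.1 = 0 ∧
      f₂.eval z.1 * z.2 ^ 2 + f₁.eval z.1 * z.2 + f₀.eval z.1 = 0 ∧
      β * z.2 ^ 3 + g₂.eval z.1 * z.2 ^ 2 + g₁.eval z.1 * z.2 + g₀.eval z.1 = 0) ↔
      (α * z.2 ^ 2 + e₁.eval z.1 * z.2 + e₀.eval z.1 = 0 ∧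
      (Polynomial.C α * f₁ - f₂ * e₁).eval z.1 * z.2 +
        (Polynomial.C α * f₀ - f₂ * e₀).eval z.1 = 0 ∧
      (Polynomial.C β * (e₁ ^ 2 - Polynomial.C α * e₀) - Polynomial.C α * (g₂ * e₁) +
        Polynomial.C (α ^ 2) * g₁).eval z.1 * z.2 + (Polynomial.C β * (e₁ * e₀) -
        Polynomial.C α * (g₂ * e₀) + Polynomial.C (α ^ 2) * g₀).eval z.1 = 0) := by
    intro z
    simp only [Polynomial.eval_add, Polynomial.eval_sub, Polynomial.eval_mul,
        Polynomial.eval_pow, Polynomial.eval_C]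
    refine and_congr_right fun h => and_congr ?_ ?_
    · rw [← mul_eq_zero_iff_left hα]
      constructor <;> intro h'
      · linear_combination h' - f₂.eval z.1 * h
      · linear_combination h' + f₂.eval z.1 * h
    · rw [← mul_eq_zero_iff_left (pow_ne_zero 2 hα)]
      constructor <;> intro h'
      · linear_combination h' - (α * g₂.eval z.1 + β * (α * z.2 - e₁.eval z.1)) * h
      · linear_combination h' + (α * g₂.eval z.1 + β * (α * z.2 - e₁.eval z.1)) * h
  simp only [hset] at hfin ⊢
  exact key hfin

/-- A finite set of common zeros of a linear, a quadratic and a cubic polynomial, the latter with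
constant leading coefficient, has at most `18` elements. -/
theorem encard_linear_quadratic_cubic_le {β : ℂ} (hβ : β ≠ 0)
    {e₁ e₀ f₂ f₁ f₀ g₂ g₁ g₀ : Polynomial ℂ} (he₁0 : e₁ ≠ 0)
    (he₁ : e₁.natDegree ≤ 2) (he₀ : e₀.natDegree ≤ 4)
    (hf₂ : f₂.natDegree ≤ 1) (hf₁ : f₁.natDegree ≤ 3) (hf₀ : f₀.natDegree ≤ 5)
    (hg₂ : g₂.natDegree ≤ 2) (hg₁ : g₁.natDegree ≤ 4) (hg₀ : g₀.natDegree ≤ 6)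
    (hfin : {z : ℂ × ℂ | e₁.eval z.1 * z.2 + e₀.eval z.1 = 0 ∧
      f₂.eval z.1 * z.2 ^ 2 + f₁.eval z.1 * z.2 + f₀.eval z.1 = 0 ∧
      β * z.2 ^ 3 + g₂.eval z.1 * z.2 ^ 2 + g₁.eval z.1 * z.2 + g₀.eval z.1 = 0}.Finite) :
    {z : ℂ × ℂ | e₁.eval z.1 * z.2 + e₀.eval z.1 = 0 ∧
      f₂.eval z.1 * z.2 ^ 2 + f₁.eval z.1 * z.2 + f₀.eval z.1 = 0 ∧
      β * z.2 ^ 3 + g₂.eval z.1 * z.2 ^ 2 + g₁.eval z.1 * z.2 + g₀.eval z.1 = 0}.encard ≤ 18 := by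
  -- The eliminants are the quadratic and the cubic at `a = -e₀ / e₁`, cleared of denominators by
  -- `e₁²` and `e₁³`. Both degrees are bounded by 12 so that `key` serves for either.
  have hd3 : (f₂ * e₀ ^ 2 - f₁ * e₀ * e₁ + f₀ * e₁ ^ 2).natDegree ≤ 12 :=
    (Polynomial.natDegree_add_le_of_degree_le (Polynomial.natDegree_sub_le_of_le (n := 9)
      (Polynomial.natDegree_mul_le_of_le hf₂ (Polynomial.natDegree_pow_le_of_le 2 he₀))
      (Polynomial.natDegree_mul_le_of_le (Polynomial.natDegree_mul_le_of_le hf₁ he₀) he₁))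
      (Polynomial.natDegree_mul_le_of_le hf₀ (Polynomial.natDegree_pow_le_of_le 2 he₁))).trans
      (by norm_num)
  have hd4 : (-(Polynomial.C β * e₀ ^ 3) + g₂ * (e₀ ^ 2 * e₁) - g₁ * (e₀ * e₁ ^ 2) +
      g₀ * e₁ ^ 3).natDegree ≤ 12 := by
    have h1 : (Polynomial.C β * e₀ ^ 3).natDegree ≤ 12 :=
      Polynomial.natDegree_mul_le_of_le (m := 0) (n := 12) (by simp)
        (Polynomial.natDegree_pow_le_of_le 3 he₀)
    exact Polynomial.natDegree_add_le_of_degree_le (Polynomial.natDegree_sub_le_of_le (n := 12)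
      (Polynomial.natDegree_add_le_of_degree_le (by rwa [Polynomial.natDegree_neg])
        (Polynomial.natDegree_mul_le_of_le hg₂ (Polynomial.natDegree_mul_le_of_le
          (Polynomial.natDegree_pow_le_of_le 2 he₀) he₁)))
      (Polynomial.natDegree_mul_le_of_le hg₁ (Polynomial.natDegree_mul_le_of_le he₀
        (Polynomial.natDegree_pow_le_of_le 2 he₁))))
      (Polynomial.natDegree_mul_le_of_le hg₀ (Polynomial.natDegree_pow_le_of_le 3 he₁))
  have key : ∀ R : Polynomial ℂ, R ≠ 0 → R.natDegree ≤ 12 →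
      (∀ z : ℂ × ℂ, e₁.eval z.1 * z.2 + e₀.eval z.1 = 0 →
        f₂.eval z.1 * z.2 ^ 2 + f₁.eval z.1 * z.2 + f₀.eval z.1 = 0 →
        β * z.2 ^ 3 + g₂.eval z.1 * z.2 ^ 2 + g₁.eval z.1 * z.2 + g₀.eval z.1 = 0 →
        R.eval z.1 = 0) →
      {z : ℂ × ℂ | e₁.eval z.1 * z.2 + e₀.eval z.1 = 0 ∧
      f₂.eval z.1 * z.2 ^ 2 + f₁.eval z.1 * z.2 + f₀.eval z.1 = 0 ∧
      β * z.2 ^ 3 + g₂.eval z.1 * z.2 ^ 2 + g₁.eval z.1 * z.2 +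
        g₀.eval z.1 = 0}.encard ≤ 18 := by
    intro R hR hRd hRZ
    refine (encard_le_natDegree_add_mul (k := 3) hR he₁0 (fun s => Polynomial.C β * Polynomial.X ^ 3 +
      Polynomial.C (g₂.eval s) * Polynomial.X ^ 2 + Polynomial.C (g₁.eval s) * Polynomial.X +
      Polynomial.C (g₀.eval s)) (fun s => cubic_ne_zero hβ _ _ _)
      (fun s => Polynomial.natDegree_cubic_le) (fun s => -e₀.eval s / e₁.eval s)
      (fun z hz => hRZ z hz.1 hz.2.1 hz.2.2) (fun z hz => by simpa using hz.2.2)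
      fun z hz hz0 => ?_).trans ?_
    · rw [eq_div_iff hz0]; linear_combination hz.1
    -- This is `12 + 2 · 3`: over a zero of `e₁` only the cubic bounds the fibre.
    · exact_mod_cast (by omega : R.natDegree + e₁.natDegree * 3 ≤ 18)
  by_cases h3 : f₂ * e₀ ^ 2 - f₁ * e₀ * e₁ + f₀ * e₁ ^ 2 = 0
  swap
  · refine key _ h3 hd3 fun z h1 h2 _ => ?_
    have h1' : e₀.eval z.1 = -(e₁.eval z.1 * z.2) := by linear_combination h1
    simp only [Polynomial.eval_add, Polynomial.eval_sub, Polynomial.eval_mul,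
        Polynomial.eval_pow, h1']
    linear_combination (e₁.eval z.1) ^ 2 * h2
  by_cases h4 : -(Polynomial.C β * e₀ ^ 3) + g₂ * (e₀ ^ 2 * e₁) - g₁ * (e₀ * e₁ ^ 2) +
      g₀ * e₁ ^ 3 = 0
  swap
  · refine key _ h4 hd4 fun z h1 _ h2 => ?_
    have h1' : e₀.eval z.1 = -(e₁.eval z.1 * z.2) := by linear_combination h1
    simp only [Polynomial.eval_add, Polynomial.eval_sub, Polynomial.eval_mul,
        Polynomial.eval_pow, Polynomial.eval_neg, Polynomial.eval_C, h1']
    linear_combination (e₁.eval z.1) ^ 3 * h2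
  refine absurd hfin (infinite_of_forall_exists he₁0 fun s hs => ⟨-e₀.eval s / e₁.eval s, ?_, ?_, ?_⟩)
  · simp only
    field_simp
    ring
  · have := congrArg (Polynomial.eval s) h3
    simp only [Polynomial.eval_add, Polynomial.eval_sub, Polynomial.eval_mul,
        Polynomial.eval_pow, Polynomial.eval_zero] at this
    simp only
    field_simp
    linear_combination this
  · have := congrArg (Polynomial.eval s) h4
    simp only [Polynomial.eval_add, Polynomial.eval_sub, Polynomial.eval_mul,
        Polynomial.eval_pow, Polynomial.eval_neg, Polynomial.eval_C, Polynomial.eval_zero] at this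
    simp only
    field_simp
    linear_combination this

/-! ### Lines as two-dimensional subspaces -/

/-- The projective line attached to a subspace. -/
def pointsOf (W : Submodule ℂ (Fin 4 → ℂ)) : Set P3 := {p : P3 | p.submodule ≤ W}

theorem pointsOf_le {W W' : Submodule ℂ (Fin 4 → ℂ)} (h : pointsOf W ⊆ pointsOf W') : W ≤ W' := by
  intro v hv
  by_cases hv0 : v = 0
  · simp [hv0]
  have h1 : Projectivization.mk ℂ v hv0 ∈ pointsOf W := by
    simp only [pointsOf, Set.mem_ofPred_eq, Projectivization.submodule_mk]
    simpa using hv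
  have h2 := h h1
  simp only [pointsOf, Set.mem_ofPred_eq, Projectivization.submodule_mk] at h2
  simpa using h2

theorem pointsOf_injective : Function.Injective pointsOf := fun _ _ h =>
  le_antisymm (pointsOf_le h.subset) (pointsOf_le h.symm.subset)

theorem pointsOf_subset_projZeros {F : Poly4} (hF : eval 0 F = 0)
    {W : Submodule ℂ (Fin 4 → ℂ)} :
    pointsOf W ⊆ projZeros {F} ↔ ∀ v ∈ W, eval v F = 0 := by
  constructor
  · intro h v hv
    by_cases hv0 : v = 0
    · rw [hv0]; exact hF
    have h1 : Projectivization.mk ℂ v hv0 ∈ pointsOf W := by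
      simp only [pointsOf, Set.mem_ofPred_eq, Projectivization.submodule_mk]
      simpa using hv
    refine h h1 F rfl v ?_
    rw [Projectivization.submodule_mk]
    exact Submodule.mem_span_singleton_self v
  · rintro h p hp f rfl v hv
    exact h v (hp hv)

theorem linesOn_eq_image {F : Poly4} (hF : eval 0 F = 0) :
    linesOn F = pointsOf '' {W | Module.finrank ℂ W = 2 ∧ ∀ v ∈ W, eval v F = 0} := by
  ext L
  constructor
  · rintro ⟨⟨W, hW, rfl⟩, hL⟩
    exact ⟨W, ⟨hW, (pointsOf_subset_projZeros hF).1 hL⟩, rfl⟩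
  · rintro ⟨W, ⟨hW, hv⟩, rfl⟩
    exact ⟨⟨W, hW, rfl⟩, (pointsOf_subset_projZeros hF).2 hv⟩

theorem finrank_span_pair_le (u v : Fin 4 → ℂ) :
    Module.finrank ℂ (Submodule.span ℂ {u, v}) ≤ 2 := by
  classical
  have := finrank_span_finset_le_card (R := ℂ) ({u, v} : Finset (Fin 4 → ℂ))
  rw [Finset.coe_pair] at this
  exact this.trans Finset.card_le_two

theorem finrank_span_pair_eq {u v : Fin 4 → ℂ} (h : LinearIndependent ℂ ![u, v]) :
    Module.finrank ℂ (Submodule.span ℂ {u, v}) = 2 := by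
  have := finrank_span_eq_card h
  rwa [Matrix.range_cons_cons_empty, Fintype.card_fin] at this

theorem eq_span_pair {W : Submodule ℂ (Fin 4 → ℂ)} (hW : Module.finrank ℂ W = 2)
    {u v : Fin 4 → ℂ} (hu : u ∈ W) (hv : v ∈ W) (h : LinearIndependent ℂ ![u, v]) :
    W = Submodule.span ℂ {u, v} := by
  symm
  refine Submodule.eq_of_le_of_finrank_eq (Submodule.span_le.2 ?_) ?_
  · rintro x (rfl | rfl) <;> assumption
  · rw [hW, finrank_span_pair_eq h]

theorem exists_ne_zero_of_coord_eq_zero {W : Submodule ℂ (Fin 4 → ℂ)}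
    (hW : Module.finrank ℂ W = 2) (i : Fin 4) : ∃ u ∈ W, u ≠ 0 ∧ u i = 0 := by
  have h := LinearMap.ker_ne_bot_of_finrank_lt (f := (LinearMap.proj (R := ℂ) i).domRestrict W)
    (by rw [hW, Module.finrank_self]; norm_num)
  obtain ⟨x, hx, hx0⟩ := Submodule.exists_mem_ne_zero_of_ne_bot h
  exact ⟨x, x.2, by simpa using hx0, by simpa using hx⟩

theorem linearIndependent_pair_of_coords {u v : Fin 4 → ℂ} {i j : Fin 4} (hui : u i = 0) (huj : u j ≠ 0)
    (hvi : v i ≠ 0) : LinearIndependent ℂ ![u, v] := by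
  rw [LinearIndependent.pair_iff]
  intro s t h
  have ht : t = 0 := by simpa [hui, hvi] using congrFun h i
  exact ⟨by simpa [ht, huj] using congrFun h j, ht⟩

/-! ### The equations of the lines off the plane `z = 0` -/

theorem eval_quarticForm {q : ℕ → ℕ → ℂ} {h : ℕ → ℕ → ℕ → ℂ} (hQ5 : Q5Conditions q h)
    (v : Fin 4 → ℂ) : eval v (quarticForm q h) =
      v 3 ^ 2 * v 2 ^ 2 + v 3 * (v 1 ^ 3 + v 2 * (q 1 1 * v 0 * v 1 + q 0 2 * v 1 ^ 2)) +
      (h 2 2 0 * v 0 ^ 2 * v 1 ^ 2 + h 1 3 0 * v 0 * v 1 ^ 3 + h 0 4 0 * v 1 ^ 4 +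
      (h 3 0 1 * v 0 ^ 3 + h 2 1 1 * v 0 ^ 2 * v 1 + h 1 2 1 * v 0 * v 1 ^ 2 +
        h 0 3 1 * v 1 ^ 3) * v 2 +
      (h 2 0 2 * v 0 ^ 2 + h 1 1 2 * v 0 * v 1 + h 0 2 2 * v 1 ^ 2) * v 2 ^ 2 +
      (h 1 0 3 * v 0 + h 0 1 3 * v 1) * v 2 ^ 3 + h 0 0 4 * v 2 ^ 4) := by
  obtain ⟨h1, h2, h3, -⟩ := hQ5
  simp only [quarticForm, formQ2, formH4, Finset.Nat.sum_antidiagonal_eq_sum_range_succ_mk,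
    Finset.sum_range_succ, Finset.sum_range_zero, map_add, map_mul, map_pow, eval_X, eval_C]
  norm_num [h1, h2, h3]
  ring

/-! ### Contact conditions along a line through a point of the plane `z = 0` -/

section Coefficients

variable (q : ℕ → ℕ → ℂ) (h : ℕ → ℕ → ℕ → ℂ)

/-- `Q₂(x, 1)`. -/
noncomputable def polyQ : Polynomial ℂ :=
  Polynomial.C (q 1 1) * Polynomial.X + Polynomial.C (q 0 2)

/-- The coefficient of `z⁰` in `H₄(x, 1, z)`. -/
noncomputable def polyA₀ : Polynomial ℂ :=
  Polynomial.C (h 2 2 0) * Polynomial.X ^ 2 + Polynomial.C (h 1 3 0) * Polynomial.X +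
    Polynomial.C (h 0 4 0)

/-- The coefficient of `z` in `H₄(x, 1, z)`. -/
noncomputable def polyA₁ : Polynomial ℂ :=
  Polynomial.C (h 3 0 1) * Polynomial.X ^ 3 + Polynomial.C (h 2 1 1) * Polynomial.X ^ 2 +
    Polynomial.C (h 1 2 1) * Polynomial.X + Polynomial.C (h 0 3 1)

/-- The coefficient of `z²` in `H₄(x, 1, z)`. -/
noncomputable def polyA₂ : Polynomial ℂ :=
  Polynomial.C (h 2 0 2) * Polynomial.X ^ 2 + Polynomial.C (h 1 1 2) * Polynomial.X +
    Polynomial.C (h 0 2 2)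

/-- The coefficient of `z³` in `H₄(x, 1, z)`. -/
noncomputable def polyA₃ : Polynomial ℂ :=
  Polynomial.C (h 1 0 3) * Polynomial.X + Polynomial.C (h 0 1 3)

/-- The derivative of `polyA₀`. -/
noncomputable def polyA₀' : Polynomial ℂ :=
  Polynomial.C (2 * h 2 2 0) * Polynomial.X + Polynomial.C (h 1 3 0)

/-- The derivative of `polyA₁`. -/
noncomputable def polyA₁' : Polynomial ℂ :=
  Polynomial.C (3 * h 3 0 1) * Polynomial.X ^ 2 + Polynomial.C (2 * h 2 1 1) * Polynomial.X +
    Polynomial.C (h 1 2 1)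

/-- Half the second derivative of `polyA₁`. -/
noncomputable def polyA₁'' : Polynomial ℂ :=
  Polynomial.C (3 * h 3 0 1) * Polynomial.X + Polynomial.C (h 2 1 1)

/-- The derivative of `polyA₂`. -/
noncomputable def polyA₂' : Polynomial ℂ :=
  Polynomial.C (2 * h 2 0 2) * Polynomial.X + Polynomial.C (h 1 1 2)

/-- The part independent of `a` of the slope `c` of a line in the tangent plane at
`(s : 1 : 0 : -A₀(s))` with direction `(a : 0 : 1 : c)`. -/
noncomputable def polyC : Polynomial ℂ := polyA₀ h * polyQ q - polyA₁ h

/-- The coefficient of `a` in the condition of second order contact. -/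
noncomputable def polyE₁ : Polynomial ℂ :=
  polyA₁' h - polyA₀' h * polyQ q - Polynomial.C (q 1 1) * polyA₀ h

/-- The constant coefficient in the condition of second order contact. -/
noncomputable def polyE₀ : Polynomial ℂ := polyA₀ h ^ 2 + polyC q h * polyQ q + polyA₂ h

/-- The coefficient of `a²` in the condition of third order contact. -/
noncomputable def polyF₂ : Polynomial ℂ := polyA₁'' h - Polynomial.C (q 1 1) * polyA₀' h

/-- The coefficient of `a` in the condition of third order contact. -/
noncomputable def polyF₁ : Polynomial ℂ :=
  2 * (polyA₀ h * polyA₀' h) + Polynomial.C (q 1 1) * polyC q h + polyA₂' h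

/-- The constant coefficient in the condition of third order contact. -/
noncomputable def polyF₀ : Polynomial ℂ := polyA₃ h - 2 * (polyA₀ h * polyC q h)

/-- The coefficient of `a²` in the condition of fourth order contact. -/
noncomputable def polyG₂ : Polynomial ℂ := polyA₀' h ^ 2 + Polynomial.C (h 2 0 2)

/-- The coefficient of `a` in the condition of fourth order contact. -/
noncomputable def polyG₁ : Polynomial ℂ :=
  Polynomial.C (h 1 0 3) - 2 * (polyC q h * polyA₀' h)

/-- The constant coefficient in the condition of fourth order contact. -/
noncomputable def polyG₀ : Polynomial ℂ := polyC q h ^ 2 + Polynomial.C (h 0 0 4)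

/-- The pairs `(s, a)` such that the line through `(s : 1 : 0 : -A₀(s))` and `(a : 0 : 1 : c)`,
where `c` is determined by tangency, lies on the quartic surface. -/
def contactPairs : Set (ℂ × ℂ) :=
  {z | h 2 2 0 * z.2 ^ 2 + (polyE₁ q h).eval z.1 * z.2 + (polyE₀ q h).eval z.1 = 0 ∧
    (polyF₂ q h).eval z.1 * z.2 ^ 2 + (polyF₁ q h).eval z.1 * z.2 + (polyF₀ q h).eval z.1 = 0 ∧
    h 3 0 1 * z.2 ^ 3 + (polyG₂ h).eval z.1 * z.2 ^ 2 + (polyG₁ q h).eval z.1 * z.2 +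
      (polyG₀ q h).eval z.1 = 0}

/-- The subspace of the line through `(s : 1 : 0 : -A₀(s))` and `(a : 0 : 1 : c)`. -/
noncomputable def contactLine (z : ℂ × ℂ) : Submodule ℂ (Fin 4 → ℂ) :=
  Submodule.span ℂ {![z.1, 1, 0, -(polyA₀ h).eval z.1],
    ![z.2, 0, 1, (polyC q h).eval z.1 - (polyA₀' h).eval z.1 * z.2]}

end Coefficients

/-- The second order condition is quadratic in `a` when `h 2 2 0 ≠ 0`. Otherwise it is linear with
slope `polyE₁`, whose `s²` coefficient is then `3 h 3 0 1 ≠ 0`. -/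
theorem encard_contactPairs_le {q : ℕ → ℕ → ℂ} {h : ℕ → ℕ → ℕ → ℂ} (h301 : h 3 0 1 ≠ 0)
    (hfin : (contactPairs q h).Finite) : (contactPairs q h).encard ≤ 20 := by
  have hQ : (polyQ q).natDegree ≤ 1 := by unfold polyQ; compute_degree
  have hA₀ : (polyA₀ h).natDegree ≤ 2 := by unfold polyA₀; compute_degree
  have hC : (polyC q h).natDegree ≤ 3 := by
    unfold polyC polyA₀ polyQ polyA₁; compute_degree
  have hA₀' : (polyA₀' h).natDegree ≤ 1 := by unfold polyA₀'; compute_degree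
  have he₁ : (polyE₁ q h).natDegree ≤ 2 := by
    unfold polyE₁ polyA₁' polyA₀' polyQ polyA₀; compute_degree
  have he₀ : (polyE₀ q h).natDegree ≤ 4 := by
    unfold polyE₀ polyA₂
    refine Polynomial.natDegree_add_le_of_degree_le (Polynomial.natDegree_add_le_of_degree_le
      (Polynomial.natDegree_pow_le_of_le 2 hA₀) (Polynomial.natDegree_mul_le_of_le hC hQ)) ?_
    compute_degree
    norm_num
  have hf₂ : (polyF₂ q h).natDegree ≤ 1 := by
    unfold polyF₂ polyA₁'' polyA₀'; compute_degree
  have hf₁ : (polyF₁ q h).natDegree ≤ 3 := by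
    unfold polyF₁
    refine Polynomial.natDegree_add_le_of_degree_le (Polynomial.natDegree_add_le_of_degree_le
      (Polynomial.natDegree_mul_le_of_le (m := 0) (n := 3) (by simp)
        (Polynomial.natDegree_mul_le_of_le hA₀ hA₀'))
      (Polynomial.natDegree_mul_le_of_le (m := 0) (n := 3) (by simp) hC)) ?_
    unfold polyA₂'; compute_degree
    norm_num
  have hf₀ : (polyF₀ q h).natDegree ≤ 5 := by
    unfold polyF₀
    refine Polynomial.natDegree_sub_le_of_le (m := 5) ?_
      (Polynomial.natDegree_mul_le_of_le (m := 0) (n := 5)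
      (Polynomial.natDegree_ofNat 2).le (Polynomial.natDegree_mul_le_of_le hA₀ hC))
    unfold polyA₃; compute_degree
    norm_num
  have hg₂ : (polyG₂ h).natDegree ≤ 2 :=
    Polynomial.natDegree_add_le_of_degree_le (Polynomial.natDegree_pow_le_of_le 2 hA₀') (by simp)
  have hg₁ : (polyG₁ q h).natDegree ≤ 4 :=
    Polynomial.natDegree_sub_le_of_le (m := 4) (by simp) (Polynomial.natDegree_mul_le_of_le (m := 0) (n := 4)
      (Polynomial.natDegree_ofNat 2).le (Polynomial.natDegree_mul_le_of_le hC hA₀'))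
  have hg₀ : (polyG₀ q h).natDegree ≤ 6 :=
    Polynomial.natDegree_add_le_of_degree_le (Polynomial.natDegree_pow_le_of_le 2 hC) (by simp)
  by_cases hα : h 2 2 0 = 0
  · have he : polyE₁ q h ≠ 0 := by
      intro h0
      have h1 := congrArg (Polynomial.eval 1) h0
      have h2 := congrArg (Polynomial.eval (-1)) h0
      have h3 := congrArg (Polynomial.eval 0) h0
      simp [polyE₁, polyA₁', polyA₀', polyQ, polyA₀, hα] at h1 h2 h3
      -- The second difference of `polyE₁` at `1, 0, -1` isolates its leading coefficient.
      exact h301 (by linear_combination (1/6) * h1 + (1/6) * h2 - (1/3) * h3)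
    simp only [contactPairs, hα, zero_mul, zero_add] at hfin ⊢
    exact (encard_linear_quadratic_cubic_le h301 he he₁ he₀ hf₂ hf₁ hf₀ hg₂ hg₁ hg₀ hfin).trans
      (by norm_num)
  · exact encard_quadratic_quadratic_cubic_le hα he₁ he₀ hf₂ hf₁ hf₀ hg₂ hg₁ hg₀ hfin

/-- The generators have `(y, z)` coordinates `(1, 0)` and `(0, 1)`, so the line determines them. -/
theorem contactLine_injective (q : ℕ → ℕ → ℂ) (h : ℕ → ℕ → ℕ → ℂ) :
    Function.Injective (contactLine q h) := by
  rintro ⟨s, a⟩ ⟨s', a'⟩ hz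
  have h1 : ![s, 1, 0, -(polyA₀ h).eval s] ∈ contactLine q h (s', a') :=
    hz ▸ Submodule.subset_span (by simp)
  have h2 : ![a, 0, 1, (polyC q h).eval s - (polyA₀' h).eval s * a] ∈ contactLine q h (s', a') :=
    hz ▸ Submodule.subset_span (by simp)
  obtain ⟨m, n, hmn⟩ := Submodule.mem_span_pair.1 h1
  obtain ⟨m', n', hmn'⟩ := Submodule.mem_span_pair.1 h2
  have e0 := congrFun hmn 0
  have e1 := congrFun hmn 1
  have e2 := congrFun hmn 2
  have e0' := congrFun hmn' 0
  have e1' := congrFun hmn' 1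
  have e2' := congrFun hmn' 2
  simp at e0 e1 e2 e0' e1' e2'
  subst e1 e2 e1' e2'
  simp at e0 e0'
  rw [e0, e0']

theorem finrank_contactLine (q : ℕ → ℕ → ℂ) (h : ℕ → ℕ → ℕ → ℂ) (z : ℂ × ℂ) :
    Module.finrank ℂ (contactLine q h z) = 2 :=
  finrank_span_pair_eq (linearIndependent_pair_of_coords (i := 2) (j := 1)
    (by simp) (by simp) (by simp))

theorem eval_quarticForm_of_mem_contactLine {q : ℕ → ℕ → ℂ} {h : ℕ → ℕ → ℕ → ℂ}
    (hQ5 : Q5Conditions q h) {z : ℂ × ℂ} (hz : z ∈ contactPairs q h) {v : Fin 4 → ℂ}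
    (hv : v ∈ contactLine q h z) : eval v (quarticForm q h) = 0 := by
  obtain ⟨m, n, rfl⟩ := Submodule.mem_span_pair.1 hv
  obtain ⟨h2, h3, h4⟩ := hz
  rw [eval_quarticForm hQ5]
  simp [polyE₁, polyE₀, polyF₂, polyF₁, polyF₀, polyG₂, polyG₁, polyG₀, polyC, polyA₀, polyA₀',
    polyA₁, polyA₁', polyA₁'', polyA₂, polyA₂', polyA₃, polyQ] at h2 h3 h4 ⊢
  -- The terms in `m⁴` and `m³ n` vanish by the choice of the two `w`-coordinates.
  linear_combination n ^ 2 * (m ^ 2 * h2 + m * n * h3 + n ^ 2 * h4)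

/-- A line on the surface which is not in the plane `z = 0` is a contact line. -/
theorem exists_contactLine_eq {q : ℕ → ℕ → ℂ} {h : ℕ → ℕ → ℕ → ℂ} (hQ5 : Q5Conditions q h)
    {W : Submodule ℂ (Fin 4 → ℂ)} (hW : Module.finrank ℂ W = 2)
    (hWF : ∀ v ∈ W, eval v (quarticForm q h) = 0) {v : Fin 4 → ℂ} (hv : v ∈ W) (hv2 : v 2 ≠ 0) :
    ∃ z ∈ contactPairs q h, contactLine q h z = W := by
  obtain ⟨u, hu, hu0, hu2⟩ := exists_ne_zero_of_coord_eq_zero hW 2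
  have h301 := hQ5.2.2.2
  -- If `u 1 = 0`, the coefficient of `t` along the line is `h 3 0 1 * u 0 ^ 3 * v 2`, forcing `u 0
  -- = 0`; the coefficient of `t²` is then `u 3 ^ 2 * v 2 ^ 2`, forcing `u = 0`. The rational
  -- constants here and below interpolate a quartic in `t` from its values at `0, ±1, ±2`.
  have hu1 : u 1 ≠ 0 := by
    intro hu1
    have hF : ∀ t : ℂ, eval (u + t • v) (quarticForm q h) = 0 := fun t =>
      hWF _ (W.add_mem hu (W.smul_mem t hv))
    simp only [eval_quarticForm hQ5, Pi.add_apply, Pi.smul_apply, smul_eq_mul, hu1, hu2] at hF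
    have hu00 : u 0 = 0 := by
      have h1 := hF 1
      have h2 := hF (-1)
      have h3 := hF 2
      have h4 := hF (-2)
      have : h 3 0 1 * u 0 ^ 3 * v 2 = 0 := by
        linear_combination (2/3) * h1 - (2/3) * h2 - (1/12) * h3 + (1/12) * h4
      simpa [h301, hv2] using this
    simp only [hu00] at hF
    have hu3 : u 3 = 0 := by
      have h0 := hF 0
      have h1 := hF 1
      have h2 := hF (-1)
      have h3 := hF 2
      have h4 := hF (-2)
      have : u 3 ^ 2 * v 2 ^ 2 = 0 := by
        linear_combination (-5/4) * h0 + (2/3) * h1 + (2/3) * h2 - (1/24) * h3 - (1/24) * h4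
      simpa [hv2] using this
    exact hu0 (by ext i; fin_cases i <;> simp [hu00, hu1, hu2, hu3])
  -- Change of basis making the `(y, z)` coordinates `(1, 0)` and `(0, 1)`.
  let u' : Fin 4 → ℂ := (u 1)⁻¹ • u
  let v' : Fin 4 → ℂ := (v 2)⁻¹ • v - ((v 2)⁻¹ * v 1) • u'
  have hu' : u' ∈ W := W.smul_mem _ hu
  have hv' : v' ∈ W := W.sub_mem (W.smul_mem _ hv) (W.smul_mem _ hu')
  have hu1' : u' 1 = 1 := by simp [u', hu1]
  have hu2' : u' 2 = 0 := by simp [u', hu2]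
  have hv1' : v' 1 = 0 := by simp [v', hu1']
  have hv2' : v' 2 = 1 := by simp [v', hu2', hv2]
  have hspan := eq_span_pair hW hu' hv'
    (linearIndependent_pair_of_coords hu2' (by simp [hu1'] : u' 1 ≠ 0) (by simp [hv2']))
  clear_value u' v'
  have hF : ∀ t : ℂ, eval (u' + t • v') (quarticForm q h) = 0 := fun t =>
    hWF _ (W.add_mem hu' (W.smul_mem t hv'))
  simp only [eval_quarticForm hQ5, Pi.add_apply, Pi.smul_apply, smul_eq_mul, hu1', hu2', hv1',
    hv2'] at hF
  have e0 := hF 0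
  have e1 := hF 1
  have e2 := hF (-1)
  have e3 := hF 2
  have e4 := hF (-2)
  -- The coefficients of `t⁰` and `t¹` are linear in `u' 3` and `v' 3` respectively, with leading
  -- coefficient 1.
  have hu3' : u' 3 = -(polyA₀ h).eval (u' 0) := by
    simp [polyA₀]
    linear_combination e0
  have hv3' : v' 3 = (polyC q h).eval (u' 0) - (polyA₀' h).eval (u' 0) * v' 0 := by
    simp [polyC, polyA₀, polyA₀', polyA₁, polyQ] at hu3' ⊢
    rw [hu3'] at e1 e2 e3 e4
    linear_combination (2/3) * e1 - (2/3) * e2 - (1/12) * e3 + (1/12) * e4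
  refine ⟨(u' 0, v' 0), ?_, ?_⟩
  · rw [hu3', hv3'] at e0 e1 e2 e3 e4
    simp [polyC, polyA₀, polyA₀', polyA₁, polyQ] at e0 e1 e2 e3 e4
    refine ⟨?_, ?_, ?_⟩ <;>
    simp [polyE₁, polyE₀, polyF₂, polyF₁, polyF₀, polyG₂, polyG₁, polyG₀, polyC, polyA₀, polyA₀',
      polyA₁, polyA₁', polyA₁'', polyA₂, polyA₂', polyA₃, polyQ]
    · linear_combination (-5/4) * e0 + (2/3) * e1 + (2/3) * e2 - (1/24) * e3 - (1/24) * e4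
    · linear_combination (-1/6) * e1 + (1/6) * e2 + (1/12) * e3 - (1/12) * e4
    · linear_combination (1/4) * e0 - (1/6) * e1 - (1/6) * e2 + (1/24) * e3 + (1/24) * e4
  · rw [hspan, contactLine]
    have h1 : ![u' 0, 1, 0, -(polyA₀ h).eval (u' 0)] = u' := by
      ext i; fin_cases i <;> simp [hu1', hu2', hu3']
    have h2 : ![v' 0, 0, 1, (polyC q h).eval (u' 0) - (polyA₀' h).eval (u' 0) * v' 0] = v' := by
      ext i; fin_cases i <;> simp [hv1', hv2', hv3']
    simp only [h1, h2]

/-! ### The lines in the plane `z = 0` -/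

/-- A line on the surface in the plane `z = 0` is one of two. -/
theorem eq_or_eq_of_le_plane {q : ℕ → ℕ → ℂ} {h : ℕ → ℕ → ℕ → ℂ} (hQ5 : Q5Conditions q h)
    {W : Submodule ℂ (Fin 4 → ℂ)} (hW : Module.finrank ℂ W = 2)
    (hWF : ∀ v ∈ W, eval v (quarticForm q h) = 0) (hW2 : ∀ v ∈ W, v 2 = 0) :
    W = Submodule.span ℂ {![1, 0, 0, 0], ![0, 0, 0, 1]} ∨
      W = Submodule.span ℂ {![1, 0, 0, -h 1 3 0], ![0, 1, 0, -h 0 4 0]} := by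
  by_cases hy : ∀ v ∈ W, v 1 = 0
  · left
    have hle : W ≤ Submodule.span ℂ {![1, 0, 0, 0], ![0, 0, 0, 1]} := fun v hv =>
      Submodule.mem_span_pair.2 ⟨v 0, v 3, by
        ext i; fin_cases i <;> simp [hy v hv, hW2 v hv]⟩
    refine Submodule.eq_of_le_of_finrank_le hle ?_
    rw [hW]
    exact finrank_span_pair_le _ _
  · right
    push Not at hy
    obtain ⟨v, hv, hv1⟩ := hy
    obtain ⟨u, hu, hu0, hu1⟩ := exists_ne_zero_of_coord_eq_zero hW 1
    -- Along this line `y` is the nonzero constant `v 1`, so the restriction is quadratic in `t`.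
    -- Its `t²` coefficient forces `h 2 2 0 * u 0 = 0`, its `t` coefficient gives `u 3`, and its
    -- constant term gives `v 3`.
    have hF : ∀ t : ℂ, eval (v + t • u) (quarticForm q h) = 0 := fun t =>
      hWF _ (W.add_mem hv (W.smul_mem t hu))
    simp only [eval_quarticForm hQ5, Pi.add_apply, Pi.smul_apply, smul_eq_mul, hu1, hW2 u hu,
      hW2 v hv] at hF
    have e0 := hF 0
    have e1 := hF 1
    have e2 := hF (-1)
    have h0 : v 3 = -h 1 3 0 * v 0 - h 0 4 0 * v 1 - h 2 2 0 * v 0 ^ 2 * (v 1)⁻¹ := by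
      field_simp
      refine mul_left_cancel₀ (pow_ne_zero 2 hv1) ?_
      linear_combination e0
    have h2 : h 2 2 0 * u 0 ^ 2 = 0 := by
      refine mul_left_cancel₀ (pow_ne_zero 2 hv1) ?_
      linear_combination (1/2) * e1 + (1/2) * e2 - e0
    have h2' : h 2 2 0 * u 0 = 0 := by
      rcases mul_eq_zero.1 h2 with h' | h'
      · simp [h']
      · simp [pow_eq_zero_iff two_ne_zero |>.1 h']
    have h3 : u 3 = -h 1 3 0 * u 0 := by
      refine mul_left_cancel₀ (pow_ne_zero 3 hv1) ?_
      linear_combination (1/2) * e1 - (1/2) * e2 - 2 * v 0 * v 1 ^ 2 * h2'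
    have hu00 : u 0 ≠ 0 := fun hu00 => hu0 (by
      ext i; fin_cases i <;> simp [hu00, hu1, hW2 u hu, h3])
    have hα : h 2 2 0 = 0 := by simpa [hu00] using h2'
    have hspan := eq_span_pair hW hu hv (linearIndependent_pair_of_coords hu1 hu00 hv1)
    refine Submodule.eq_of_le_of_finrank_le ?_ (by rw [hW]; exact finrank_span_pair_le _ _)
    rw [hspan, Submodule.span_le]
    rintro x (rfl | rfl)
    · refine Submodule.mem_span_pair.2 ⟨x 0, 0, ?_⟩
      ext i; fin_cases i <;> simp [hu1, hW2 x hu, h3]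
      ring
    · refine Submodule.mem_span_pair.2 ⟨x 0, x 1, ?_⟩
      ext i; fin_cases i <;> simp [hW2 x hv, h0, hα]
      ring

/-! ### The count -/

/-- If the quartic surface contains finitely many lines, it contains at most `22`: at most `20`
of them are not in the tangent cone `z = 0` at `O`, and at most two are. -/
theorem encard_linesOn_quarticForm_le {q : ℕ → ℕ → ℂ} {h : ℕ → ℕ → ℕ → ℂ}
    (hQ5 : Q5Conditions q h) (hfin : (linesOn (quarticForm q h)).Finite) :
    (linesOn (quarticForm q h)).encard ≤ 22 := by
  have hzero : eval 0 (quarticForm q h) = 0 := by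
    rw [eval_quarticForm hQ5]
    simp
  rw [linesOn_eq_image hzero] at hfin ⊢
  set 𝒲 := {W : Submodule ℂ (Fin 4 → ℂ) | Module.finrank ℂ W = 2 ∧
    ∀ v ∈ W, eval v (quarticForm q h) = 0} with h𝒲
  have hfin𝒲 : 𝒲.Finite := hfin.of_finite_image pointsOf_injective.injOn
  have hsub : contactLine q h '' contactPairs q h ⊆ 𝒲 := by
    rintro _ ⟨z, hz, rfl⟩
    exact ⟨finrank_contactLine q h z, fun v hv => eval_quarticForm_of_mem_contactLine hQ5 hz hv⟩
  -- Finiteness passes from lines to pairs because distinct pairs give distinct lines on the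
  -- surface.
  have hpairs : (contactPairs q h).Finite :=
    (hfin𝒲.subset hsub).of_finite_image (contactLine_injective q h).injOn
  have hcover : 𝒲 ⊆ contactLine q h '' contactPairs q h ∪
      {Submodule.span ℂ {![1, 0, 0, 0], ![0, 0, 0, 1]},
        Submodule.span ℂ {![1, 0, 0, -h 1 3 0], ![0, 1, 0, -h 0 4 0]}} := by
    rintro W ⟨hW, hWF⟩
    by_cases hW2 : ∀ v ∈ W, v 2 = 0
    · exact Or.inr (eq_or_eq_of_le_plane hQ5 hW hWF hW2)
    · push Not at hW2
      obtain ⟨v, hv, hv2⟩ := hW2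
      exact Or.inl (exists_contactLine_eq hQ5 hW hWF hv hv2)
  calc (pointsOf '' 𝒲).encard ≤ 𝒲.encard := Set.encard_image_le _ _
    _ ≤ _ := Set.encard_le_encard hcover
    _ ≤ _ := Set.encard_union_le _ _
    _ ≤ 20 + 2 := add_le_add ((Set.encard_image_le _ _).trans
      (encard_contactPairs_le hQ5.2.2.2 hpairs)) ((Set.encard_insert_le _ _).trans
        (by rw [Set.encard_singleton]; norm_num))
    _ = 22 := by norm_num

theorem lemma3p5 (q : ℕ → ℕ → ℂ) (h : ℕ → ℕ → ℕ → ℂ) (hQ5 : Q5Conditions q h)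
    (hfin : (linesOn (quarticForm q h)).Finite)
    (ℓ₀ : Set P3) (hℓ₀ : ℓ₀ ∈ linesOn (quarticForm q h)) (hO : pointO ∈ ℓ₀) :
    (∀ K : Set P3, TangentConeSectionEq (quarticForm q h) 2 1 ℓ₀ 2 K →
      {L ∈ linesOn (quarticForm q h) | (L ∩ K).Nonempty}.encard ≤ 27) ∧
    (∀ ℓ₁ : Set P3, TangentConeSectionEq (quarticForm q h) 3 1 ℓ₀ 1 ℓ₁ →
      {L ∈ linesOn (quarticForm q h) | (L ∩ ℓ₁).Nonempty}.encard ≤ 23) := by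
  have hle := encard_linesOn_quarticForm_le hQ5 hfin
  exact ⟨fun K _ => (Set.encard_le_encard (Set.sep_subset _ _)).trans (hle.trans (by norm_num)),
    fun ℓ₁ _ => (Set.encard_le_encard (Set.sep_subset _ _)).trans (hle.trans (by norm_num))⟩
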